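/- Let $\mathcal A$ be a C*-algebra (not necessarily unital) and let $\mathcal B$ be a C*-subalgebra of $\mathcal A$ that contains a bounded approximate identity for $\mathcal A$. For $A\in\mathcal A$ put $L(A)=\inf\{\|A-B\| : B\in\mathcal B\}$. A $*$-representation $(\mathcal H,\pi)$ of $\mathcal A$ on a Hilbert space is called non-degenerate if $\pi(\mathcal A)\mathcal H$ spans a dense subspace of $\mathcal H$; write $[S,T]=ST-TS$. (1) For every $A\in\mathcal A$ there are a non-degenerate $*$-representation $(\mathcal H,\pi)$ of $\mathcal A$ and a Hermitian unitary operator $U$ on $\mathcal H$ such that $[U,\pi(B)]=0$ for all $B\in\mathcal B$ and $$L(A)=\tfrac12\,\|[U,\pi(A)]\|.$$ (2) $L$ is the (pointwise) supremum of the seminorms $L_{(\mathcal H,\pi,U)}(C)=\tfrac12\|[U,\pi(C)]\|$, $C\in\mathcal A$, as $(\mathcal H,\pi,U)$ ranges over all non-degenerate $*$-representations $(\mathcal H,\pi)$ of $\mathcal A$ and all Hermitian unitary operators $U$ on $\mathcal H$ such that $[U,\pi(B)]=0$ for all $B\in\mathcal B$. (3) Each seminorm $L_{(\mathcal H,\pi,U)}$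 is Leibniz, and so is $L$: that is, $L(AC)\le L(A)\|C\|+\|A\|L(C)$ for all $A,C\in\mathcal A$, and likewise for $L_{(\mathcal H,\pi,U)}$. (4) If $\mathcal A$ is unital and $1_{\mathcal A}\in\mathcal B$, then $L$ is strongly Leibniz: $L$ is Leibniz, $L(1_{\mathcal A})=0$, and $L(A^{-1})\le\|A^{-1}\|^2L(A)$ for every invertible $A\in\mathcal A$. -/

import Mathlib

open Filter

universe u v

namespace CStarDist

/-- A net (here: a filter) of elements of `B`, bounded in norm, that is a two-sided approximate
identity for the whole algebra `A`. -/
def ContainsBoundedApproximateIdentity {A : Type u} [NonUnitalCStarAlgebra A]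
    (B : NonUnitalStarSubalgebra ℂ A) : Prop :=
  ∃ l : Filter A, l.IsApproximateUnit ∧ (∀ᶠ e in l, e ∈ B) ∧ ∃ M : ℝ, ∀ᶠ e in l, ‖e‖ ≤ M

section QuotientSeminorm

variable {A : Type u} [NonUnitalCStarAlgebra A] (B : NonUnitalStarSubalgebra ℂ A)

theorem bddBelow_norm_sub (a : A) : BddBelow (Set.range fun b : B => ‖a - (b : A)‖) :=
  ⟨0, by rintro _ ⟨b, rfl⟩; exact norm_nonneg _⟩

theorem iInf_norm_sub_add_le (a c : A) :
    (⨅ b : B, ‖a + c - (b : A)‖) ≤ (⨅ b : B, ‖a - (b : A)‖) + ⨅ b : B, ‖c - (b : A)‖ := by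
  refine le_ciInf_add_ciInf fun b b' => ?_
  refine (ciInf_le (bddBelow_norm_sub B (a + c)) (b + b')).trans ?_
  have h : a + c - ((b + b' : B) : A) = (a - b) + (c - b') := by
    push_cast
    abel
  rw [h]
  exact norm_add_le _ _

theorem iInf_norm_sub_smul_le (t : ℂ) (a : A) :
    (⨅ b : B, ‖t • a - (b : A)‖) ≤ ‖t‖ * ⨅ b : B, ‖a - (b : A)‖ := by
  rw [Real.mul_iInf_of_nonneg (norm_nonneg t)]
  refine le_ciInf fun b => (ciInf_le (bddBelow_norm_sub B (t • a)) (t • b)).trans ?_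
  rw [← norm_smul, smul_sub]
  exact le_of_eq rfl

theorem iInf_norm_sub_zero : (⨅ b : B, ‖(0 : A) - (b : A)‖) = 0 :=
  le_antisymm ((ciInf_le (bddBelow_norm_sub B 0) 0).trans (by simp))
    (le_ciInf fun _ => norm_nonneg _)

/-- The seminorm `L(a) = inf {‖a - b‖ : b ∈ B}`. -/
noncomputable def quotientSeminorm : Seminorm ℂ A :=
  Seminorm.ofSMulLE (fun a => ⨅ b : B, ‖a - (b : A)‖) (iInf_norm_sub_zero B)
    (iInf_norm_sub_add_le B) (iInf_norm_sub_smul_le B)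

end QuotientSeminorm

/-- A `*`-representation is non-degenerate if the vectors `π(a)ξ` span a dense subspace. -/
def IsNondegenerate {A : Type u} [NonUnitalCStarAlgebra A] {H : Type v} [NormedAddCommGroup H]
    [InnerProductSpace ℂ H] [CompleteSpace H] (π : A →⋆ₙₐ[ℂ] (H →L[ℂ] H)) : Prop :=
  (Submodule.span ℂ {x : H | ∃ (a : A) (ξ : H), π a ξ = x}).topologicalClosure = ⊤

/-- A triple `(H, π, U)`: a non-degenerate `*`-representation `π` of `A` on a Hilbert space `H`, and
a Hermitian unitary operator `U` on `H` with `[U, π(b)] = 0` for all `b ∈ B`. -/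
structure Triple {A : Type u} [NonUnitalCStarAlgebra A] (B : NonUnitalStarSubalgebra ℂ A) where
  H : Type v
  [normed : NormedAddCommGroup H]
  [inner : InnerProductSpace ℂ H]
  [complete : CompleteSpace H]
  π : A →⋆ₙₐ[ℂ] (H →L[ℂ] H)
  nondegenerate : IsNondegenerate π
  U : H →L[ℂ] H
  hermitian : IsSelfAdjoint U
  unitary_mem : U ∈ unitary (H →L[ℂ] H)
  commutes : ∀ b ∈ B, ⁅U, π b⁆ = 0

attribute [instance] Triple.normed Triple.inner Triple.complete

/-- The seminorm `L_(H, π, U)(c) = (1/2) ‖[U, π(c)]‖`. -/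
noncomputable def Triple.seminorm {A : Type u} [NonUnitalCStarAlgebra A]
    {B : NonUnitalStarSubalgebra ℂ A} (T : Triple.{u, v} B) : Seminorm ℂ A :=
  Seminorm.of (fun c => (1 / 2 : ℝ) * ‖⁅T.U, T.π c⁆‖)
    (fun c d => by
      have h : ⁅T.U, T.π (c + d)⁆ = ⁅T.U, T.π c⁆ + ⁅T.U, T.π d⁆ := by
        rw [map_add, Ring.lie_def, Ring.lie_def, Ring.lie_def, mul_add, add_mul]
        abel
      rw [h, ← mul_add]
      exact mul_le_mul_of_nonneg_left (norm_add_le _ _) (by norm_num))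
    (fun t c => by
      have h : ⁅T.U, T.π (t • c)⁆ = t • ⁅T.U, T.π c⁆ := by
        rw [map_smul, Ring.lie_def, Ring.lie_def, mul_smul_comm, smul_mul_assoc, smul_sub]
      rw [h, norm_smul]
      ring)

/-- The Leibniz inequality for a seminorm on a C*-algebra. -/
def IsLeibniz {A : Type u} [NonUnitalCStarAlgebra A] (L : Seminorm ℂ A) : Prop :=
  ∀ a c : A, L (a * c) ≤ L a * ‖c‖ + ‖a‖ * L c

/-- `e` is a (then the unique) identity element of `A`. -/
def IsIdentity {A : Type u} [NonUnitalCStarAlgebra A] (e : A) : Prop :=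
  ∀ a : A, e * a = a ∧ a * e = a

/-- The strong Leibniz property on a C*-algebra with identity element `e`; here `a'` is the inverse
of an invertible element `a`. -/
def IsStronglyLeibniz {A : Type u} [NonUnitalCStarAlgebra A] (e : A) (L : Seminorm ℂ A) : Prop :=
  IsLeibniz L ∧ L e = 0 ∧
    ∀ a a' : A, a * a' = e → a' * a = e → L a' ≤ ‖a'‖ ^ 2 * L a

end CStarDist

/-! If `b ∈ B` then `[U, π(c)] = [U, π(c - b)]`, of norm at most `2‖c - b‖`, so every triple bounds
`L` from below. For equality at `a`, Hahn–Banach gives a contractive functional `f` killing `B` with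
`f a = L(a)`. A positive `φ` with `|f x|² ≤ φ(x⋆x) ≤ ‖x‖²` (`exists_positive_majorant`) turns `f`
into `⟪η, j ·⟫` on the GNS space of `φ`, with `‖η‖ ≤ 1`. Let `P` project onto the closure `K` of
`j(B)`: it commutes with `π(B)`, and `η ⟂ K`. For contractive `w ∈ B`, `⟪η, [P, π(a)] j(w)⟫ = -f(a
w)`; letting `a w → a` gives `‖[P, π(a)]‖ ≥ L(a)`, so `U = 2P - 1` works (`exists_triple_eq`).

Commutators are derivations, so each triple seminorm has the Leibniz properties, and `L` inherits
them because it is an attained supremum. -/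

namespace CStarDist

/-! ### Separating a cone from the strict epigraph of the norm -/

section Separation

/-- The cone misses the open convex set `‖x‖ < r`. A separating functional has negative slope in the
`ℝ` coordinate, and dividing by minus that slope yields `φ`. -/
theorem exists_dual_le_norm_of_convexCone {E : Type*} [NormedAddCommGroup E] [NormedSpace ℝ E]
    (C : ConvexCone ℝ (E × ℝ)) (h0 : (0 : E × ℝ) ∈ C) (h : ∀ p ∈ C, p.2 ≤ ‖p.1‖) :
    ∃ φ : E →L[ℝ] ℝ, (∀ x, φ x ≤ ‖x‖) ∧ ∀ p ∈ C, p.2 ≤ φ p.1 := by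
  have hconv : Convex ℝ {p : E × ℝ | ‖p.1‖ < p.2} := by
    intro p hp q hq a b ha hb hab
    simp only [Set.mem_ofPred_eq] at hp hq ⊢
    refine (norm_add_le _ _).trans_lt ?_
    simp only [Prod.smul_fst, Prod.snd_add, Prod.smul_snd, norm_smul, Real.norm_eq_abs,
      abs_of_nonneg ha, abs_of_nonneg hb, smul_eq_mul]
    rcases ha.eq_or_lt with rfl | ha
    · rw [zero_add] at hab
      simpa [hab] using hq
    · nlinarith [mul_lt_mul_of_pos_left hp ha, mul_le_mul_of_nonneg_left hq.le hb]
  have hopen : IsOpen {p : E × ℝ | ‖p.1‖ < p.2} :=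
    isOpen_lt continuous_fst.norm continuous_snd
  have hdisj : Disjoint {p : E × ℝ | ‖p.1‖ < p.2} (C : Set (E × ℝ)) :=
    Set.disjoint_left.2 fun p hp hpC => (h p hpC).not_gt hp
  obtain ⟨F, t, hF, hC⟩ := geometric_hahn_banach_open hconv hopen C.convex hdisj
  have ht : t ≤ 0 := by simpa using hC 0 h0
  have hCnonneg : ∀ p ∈ C, 0 ≤ F p := by
    intro p hp
    by_contra! hneg
    -- Rescaling `p` by this factor moves `F` to `t - 1`, below the separating level.
    have hs : 0 < (t - 1) / F p := div_pos_of_neg_of_neg (by linarith) hneg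
    have := hC _ (C.smul_mem hs hp)
    rw [map_smul, smul_eq_mul, div_mul_cancel₀ _ hneg.ne] at this
    linarith
  set c : ℝ := F (0, 1) with hc
  have hsplit : ∀ (x : E) (r : ℝ), F (x, r) = F (x, 0) + r * c := by
    intro x r
    rw [hc, ← smul_eq_mul, ← map_smul, ← map_add]
    simp
  have hcneg : c < 0 := (hF (0, 1) (by simp)).trans_le ht
  have hle : ∀ x : E, F (x, 0) ≤ -c * ‖x‖ := by
    intro x
    have hlim : ∀ ε > 0, F (x, 0) ≤ -c * ‖x‖ + ε := by
      intro ε hε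
      have hp : 0 < ε / -c := div_pos hε (by linarith)
      have := hF (x, ‖x‖ + ε / -c) (by simpa using hp)
      rw [hsplit, add_mul] at this
      have h2 : ε / -c * c = -ε := by rw [div_neg, neg_mul, div_mul_cancel₀ _ hcneg.ne]
      linarith
    exact le_of_forall_pos_le_add hlim
  refine ⟨(-c)⁻¹ • F.comp (ContinuousLinearMap.inl ℝ E ℝ), fun x => ?_, fun p hp => ?_⟩
  · simp only [smul_apply, ContinuousLinearMap.comp_apply,
      ContinuousLinearMap.inl_apply, smul_eq_mul]
    rw [inv_mul_le_iff₀ (by linarith)]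
    exact hle x
  · simp only [smul_apply, ContinuousLinearMap.comp_apply,
      ContinuousLinearMap.inl_apply, smul_eq_mul]
    rw [le_inv_mul_iff₀ (by linarith)]
    have h1 := hCnonneg p hp
    rw [← Prod.mk.eta (p := p), hsplit] at h1
    linarith

end Separation

/-! ### Positive majorants of contractive functionals -/

section Majorant

open scoped ComplexOrder

variable {A : Type u} [NonUnitalCStarAlgebra A] [PartialOrder A] [StarOrderedRing A]

/-- Joint operator convexity of `(x, p) ↦ x⋆x / p`; it makes `majorantCone` closed under addition.
-/
theorem star_add_mul_add_le {x y s t : A} {p q : ℝ} (hp : 0 ≤ p) (hq : 0 ≤ q) (hs : 0 ≤ s)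
    (ht : 0 ≤ t) (hx : star x * x ≤ p • s) (hy : star y * y ≤ q • t) :
    star (x + y) * (x + y) ≤ (p + q) • (s + t) := by
  rcases hp.eq_or_lt with rfl | hp
  · have hx0 : x = 0 := by
      rw [zero_smul] at hx
      exact CStarRing.star_mul_self_eq_zero_iff x |>.1 (le_antisymm hx (star_mul_self_nonneg x))
    rw [hx0, zero_add, zero_add, smul_add]
    exact hy.trans (le_add_of_nonneg_left (smul_nonneg hq hs))
  rcases hq.eq_or_lt with rfl | hq
  · have hy0 : y = 0 := by
      rw [zero_smul] at hy
      exact CStarRing.star_mul_self_eq_zero_iff y |>.1 (le_antisymm hy (star_mul_self_nonneg y))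
    rw [hy0, add_zero, add_zero, smul_add]
    exact hx.trans (le_add_of_nonneg_right (smul_nonneg hp.le ht))
  -- Expanding this square bounds the cross terms `x⋆y + y⋆x` by `(q/p) x⋆x + (p/q) y⋆y`.
  have key : 0 ≤ (p * q)⁻¹ • (star (q • x - p • y) * (q • x - p • y)) :=
    smul_nonneg (by positivity) (star_mul_self_nonneg _)
  have expand : (p * q)⁻¹ • (star (q • x - p • y) * (q • x - p • y)) =
      (q / p) • (star x * x) + (p / q) • (star y * y) - star x * y - star y * x := by
    simp only [star_sub, star_smul, star_trivial, sub_mul, mul_sub, smul_mul_assoc,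
      mul_smul_comm, smul_sub, smul_smul]
    have e1 : (p * q)⁻¹ * (q * q) = q / p := by field_simp
    have e2 : (p * q)⁻¹ * (p * p) = p / q := by field_simp
    have e3 : (p * q)⁻¹ * (q * p) = 1 := by field_simp
    have e4 : (p * q)⁻¹ * (p * q) = 1 := by field_simp
    simp only [e1, e2, e3, e4, one_smul]
    abel
  rw [expand] at key
  have h1 : (q / p) • (star x * x) ≤ q • s := by
    refine (smul_le_smul_of_nonneg_left hx (by positivity)).trans_eq ?_
    rw [smul_smul, div_mul_cancel₀ _ hp.ne']
  have h2 : (p / q) • (star y * y) ≤ p • t := by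
    refine (smul_le_smul_of_nonneg_left hy (by positivity)).trans_eq ?_
    rw [smul_smul, div_mul_cancel₀ _ hq.ne']
  have h3 : star x * y + star y * x ≤ q • s + p • t := by
    refine le_trans ?_ (add_le_add h1 h2)
    rw [← sub_nonneg]
    convert key using 1
    abel
  calc star (x + y) * (x + y)
      = star x * x + star y * y + (star x * y + star y * x) := by
        rw [star_add, add_mul, mul_add, mul_add]; abel
    _ ≤ p • s + q • t + (q • s + p • t) := add_le_add (add_le_add hx hy) h3
    _ = (p + q) • (s + t) := by rw [smul_add, add_smul, add_smul]; abel

/-- The cone of pairs `(s, r)` generated by the pairs `(a⋆ a, |f a|²)` is contained in this one. -/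
def majorantCone (f : A →L[ℂ] ℂ) : ConvexCone ℝ (A × ℝ) where
  carrier := {p | 0 ≤ p.1 ∧ 0 ≤ p.2 ∧ ∃ x : A, f x = (p.2 : ℂ) ∧ star x * x ≤ p.2 • p.1}
  smul_mem' := by
    rintro c hc ⟨s, r⟩ ⟨hs, hr, x, hx, hle⟩
    refine ⟨smul_nonneg hc.le hs, mul_nonneg hc.le hr, c • x, ?_, ?_⟩
    · rw [← Complex.coe_smul, map_smul, hx]
      simp
    · simp only [Prod.smul_snd, Prod.smul_fst, star_smul, star_trivial, smul_mul_smul_comm,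
        smul_eq_mul] at hle ⊢
      refine (smul_le_smul_of_nonneg_left hle (mul_nonneg hc.le hc.le)).trans_eq ?_
      rw [smul_smul, smul_smul]
      congr 1
      ring
  add_mem' := by
    rintro ⟨s, r⟩ ⟨hs, hr, x, hx, hle⟩ ⟨s', r'⟩ ⟨hs', hr', x', hx', hle'⟩
    refine ⟨add_nonneg hs hs', add_nonneg hr hr', x + x', ?_,
      star_add_mul_add_le hr hr' hs hs' hle hle'⟩
    rw [map_add, hx, hx']
    simp

/-- From `r = f x ≤ ‖x‖` and `‖x‖² ≤ r‖s‖` one gets `r² ≤ r‖s‖`. -/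
theorem le_norm_of_mem_majorantCone {f : A →L[ℂ] ℂ} (hf : ‖f‖ ≤ 1) {p : A × ℝ}
    (hp : p ∈ majorantCone f) : p.2 ≤ ‖p.1‖ := by
  obtain ⟨s, r⟩ := p
  obtain ⟨hs, hr, x, hx, hle⟩ := hp
  simp only at hs hr hx hle ⊢
  rcases hr.eq_or_lt with rfl | hr'
  · exact norm_nonneg _
  have h1 : r ≤ ‖x‖ := by
    have := f.le_of_opNorm_le hf x
    rwa [hx, Complex.norm_real, Real.norm_of_nonneg hr, one_mul] at this
  have h2 : ‖x‖ * ‖x‖ ≤ r * ‖s‖ := by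
    rw [← CStarRing.norm_star_mul_self]
    refine (CStarAlgebra.norm_le_norm_of_nonneg_of_le (star_mul_self_nonneg x) hle).trans_eq ?_
    rw [norm_smul, Real.norm_of_nonneg hr]
  nlinarith [mul_self_le_mul_self hr h1]

theorem star_mul_self_mem_majorantCone (f : A →L[ℂ] ℂ) (a : A) :
    (star a * a, ‖f a‖ ^ 2) ∈ majorantCone f := by
  -- The scalar `conj (f a)` makes the value of `f` equal to `|f a|²`.
  refine ⟨star_mul_self_nonneg a, by positivity, star (f a) • a, ?_, ?_⟩
  · rw [map_smul, smul_eq_mul]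
    simpa using Complex.conj_mul' (f a)
  · simp only [star_smul, star_star, smul_mul_smul_comm]
    rw [← Complex.coe_smul, Complex.star_def, Complex.mul_conj']
    simp

/-- Every functional of norm at most one is dominated by a positive functional of norm at most
one. -/
theorem exists_positive_majorant (f : A →L[ℂ] ℂ) (hf : ‖f‖ ≤ 1) :
    ∃ φ : A →ₚ[ℂ] ℂ, (∀ a, (φ (star a * a)).re ≤ ‖a‖ ^ 2) ∧
      ∀ a, ‖f a‖ ^ 2 ≤ (φ (star a * a)).re := by
  obtain ⟨ψ, hψ, hψC⟩ := exists_dual_le_norm_of_convexCone (majorantCone f)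
    (by simpa [← Prod.zero_eq_mk] using star_mul_self_mem_majorantCone f 0)
    (fun p hp => le_norm_of_mem_majorantCone hf hp)
  have hψf : ∀ a, ‖f a‖ ^ 2 ≤ ψ (star a * a) := fun a =>
    hψC _ (star_mul_self_mem_majorantCone f a)
  -- `ψ` is only real linear. After symmetrizing under `star`, `ψs (i x) = 0` for self-adjoint `x`,
  -- so the complexification agrees with `ψ` there.
  let ψs : A →ₗ[ℝ] ℝ :=
    { toFun := fun x => (ψ x + ψ (star x)) / 2
      map_add' := fun x y => by simp only [star_add, map_add]; ring
      map_smul' := fun c x => by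
        simp only [star_smul, star_trivial, map_smul, smul_eq_mul, RingHom.id_apply]; ring }
  have hψs : ∀ x : A, ψs x = (ψ x + ψ (star x)) / 2 := fun x => rfl
  have hsa : ∀ x : A, IsSelfAdjoint x → Module.Dual.extendRCLike (𝕜 := ℂ) ψs x = (ψ x : ℂ) := by
    intro x hx
    rw [Module.Dual.extendRCLike_apply, hψs, hψs, star_smul, hx.star_eq]
    simp
  refine ⟨PositiveLinearMap.mk₀ (Module.Dual.extendRCLike (𝕜 := ℂ) ψs) ?_, ?_, ?_⟩
  · intro x hx
    obtain ⟨a, rfl⟩ := CStarAlgebra.nonneg_iff_eq_star_mul_self.1 hx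
    rw [hsa _ (IsSelfAdjoint.star_mul_self a)]
    exact_mod_cast (sq_nonneg _).trans (hψf a)
  · intro a
    have := hsa _ (IsSelfAdjoint.star_mul_self a)
    change (Module.Dual.extendRCLike (𝕜 := ℂ) ψs (star a * a)).re ≤ _
    rw [this, Complex.ofReal_re, sq, ← CStarRing.norm_star_mul_self]
    exact hψ _
  · intro a
    have := hsa _ (IsSelfAdjoint.star_mul_self a)
    change _ ≤ (Module.Dual.extendRCLike (𝕜 := ℂ) ψs (star a * a)).re
    rw [this, Complex.ofReal_re]
    exact hψf a

end Majorant

end CStarDist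

namespace CStarDist

/-! ### GNS representation and contractive approximate identities -/

section Representation

variable {A : Type u} [NonUnitalCStarAlgebra A]

open scoped ComplexOrder InnerProductSpace in
/-- A functional of norm at most one is a vector functional on a representation space which is
generated by the image of `A`. -/
theorem exists_representation_of_functional (f : A →L[ℂ] ℂ) (hf : ‖f‖ ≤ 1) :
    ∃ (H : Type u) (_ : NormedAddCommGroup H) (_ : InnerProductSpace ℂ H) (_ : CompleteSpace H)
      (π : A →⋆ₙₐ[ℂ] (H →L[ℂ] H)) (j : A →ₗ[ℂ] H) (η : H), DenseRange j ∧
      (∀ a x, π a (j x) = j (a * x)) ∧ (∀ a, ‖j a‖ ≤ ‖a‖) ∧ ‖η‖ ≤ 1 ∧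
      ∀ a, ⟪η, j a⟫_ℂ = f a := by
  let := CStarAlgebra.spectralOrder A
  have := CStarAlgebra.spectralOrderedRing A
  obtain ⟨φ, hφ, hfφ⟩ := exists_positive_majorant f hf
  have hnorm : ∀ x : φ.PreGNS, ‖x‖ ^ 2 = (φ (star (φ.ofPreGNS x) * φ.ofPreGNS x)).re := by
    intro x
    rw [← φ.preGNS_norm_sq x, ← Complex.ofReal_pow, Complex.ofReal_re]
  -- The majorant makes `f` contractive for the GNS seminorm, so it extends to the completion; `η`
  -- is its Riesz vector.
  let g : φ.PreGNS →L[ℂ] ℂ := (f.toLinearMap ∘ₗ φ.ofPreGNS.toLinearMap).mkContinuous 1 fun x => by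
    rw [one_mul, ← sq_le_sq₀ (norm_nonneg _) (norm_nonneg _), hnorm]
    exact hfφ _
  have hg : ∀ a : A, g (φ.toPreGNS a) = f a := fun a => rfl
  have hgnorm : ‖g‖ ≤ 1 := LinearMap.mkContinuous_norm_le _ zero_le_one _
  let ι : φ.PreGNS →L[ℂ] φ.GNS := UniformSpace.Completion.toComplL
  have hι : DenseRange ι := UniformSpace.Completion.denseRange_coe
  let G : φ.GNS →L[ℂ] ℂ := g.extend ι
  have hG : ∀ x, G (ι x) = g x := fun x =>
    ContinuousLinearMap.extend_eq g hι (UniformSpace.Completion.isUniformInducing_coe _) x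
  have hGle : ∀ y, ‖G y‖ ≤ ‖y‖ := by
    intro y
    refine hι.induction_on (p := fun y => ‖G y‖ ≤ ‖y‖) y
      (isClosed_le G.continuous.norm continuous_norm) fun x => ?_
    rw [hG]
    refine (g.le_of_opNorm_le hgnorm x).trans_eq ?_
    rw [one_mul]
    exact (UniformSpace.Completion.norm_coe x).symm
  refine ⟨φ.GNS, inferInstance, inferInstance, inferInstance, φ.gnsNonUnitalStarAlgHom,
    ι.toLinearMap ∘ₗ φ.toPreGNS.toLinearMap, (InnerProductSpace.toDual ℂ φ.GNS).symm G,
    ?_, ?_, ?_, ?_, ?_⟩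
  · exact hι.comp φ.toPreGNS.surjective.denseRange ι.continuous
  · intro a x
    exact φ.gnsNonUnitalStarAlgHom_apply_coe
  · intro a
    change ‖((φ.toPreGNS a : φ.PreGNS) : φ.GNS)‖ ≤ ‖a‖
    rw [UniformSpace.Completion.norm_coe, ← sq_le_sq₀ (norm_nonneg _) (norm_nonneg _), hnorm]
    exact hφ a
  · rw [LinearIsometryEquiv.norm_map]
    exact G.opNorm_le_bound zero_le_one fun y => by simpa using hGle y
  · intro a
    rw [InnerProductSpace.toDual_symm_apply]
    exact hG _

/-- A closed star subalgebra containing an approximate identity contains one of norm at most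
one. -/
theorem exists_norm_le_one_mul_sub_lt {B : NonUnitalStarSubalgebra ℂ A}
    (hB : IsClosed (B : Set A)) (hBA : ContainsBoundedApproximateIdentity B) (a : A) {ε : ℝ}
    (hε : 0 < ε) : ∃ w ∈ B, ‖w‖ ≤ 1 ∧ ‖a * w - a‖ < ε := by
  obtain ⟨l, hl, hlB, -⟩ := hBA
  have := hl.neBot
  have h1 : ∀ᶠ e in l, ‖a * e - a‖ < ε / 3 := by
    simpa [dist_eq_norm] using (Metric.tendsto_nhds.1 (hl.tendsto_mul_left a)) (ε / 3) (by linarith)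
  obtain ⟨e, he, heB⟩ := (h1.and hlB).exists
  have := hB
  let := CStarAlgebra.spectralOrder B
  have := CStarAlgebra.spectralOrderedRing B
  -- As a C*-algebra, `B` has a contractive approximate unit of its own. It is close to a unit for
  -- `e ∈ B`, and `a e` is already close to `a`.
  have hw := CStarAlgebra.increasingApproximateUnit B
  have := hw.neBot
  have hδ : 0 < ε / (3 * (‖a‖ + 1)) := by positivity
  have h2 : ∀ᶠ w in CStarAlgebra.approximateUnit B,
      ‖(⟨e, heB⟩ : B) * w - ⟨e, heB⟩‖ < ε / (3 * (‖a‖ + 1)) := by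
    simpa [dist_eq_norm] using (Metric.tendsto_nhds.1 (hw.tendsto_mul_left ⟨e, heB⟩)) _ hδ
  obtain ⟨w, hwe, hw1⟩ := (h2.and hw.eventually_norm).exists
  have hw1 : ‖(w : A)‖ ≤ 1 := hw1
  have hwe : ‖e * (w : A) - e‖ < ε / (3 * (‖a‖ + 1)) := hwe
  refine ⟨w, w.2, hw1, ?_⟩
  have hsplit : a * (w : A) - a = (a * e - a) + a * (e * w - e) - (a * e - a) * w := by
    simp only [mul_sub, sub_mul, mul_assoc]
    abel
  have b1 : ‖a * (e * (w : A) - e)‖ ≤ ε / 3 := by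
    refine (norm_mul_le _ _).trans ?_
    have : ‖a‖ * ‖e * (w : A) - e‖ ≤ (‖a‖ + 1) * (ε / (3 * (‖a‖ + 1))) := by
      gcongr
      linarith
    refine this.trans_eq ?_
    field_simp
  have b2 : ‖(a * e - a) * (w : A)‖ < ε / 3 := by
    refine (norm_mul_le _ _).trans_lt ?_
    nlinarith [norm_nonneg (a * e - a), norm_nonneg (w : A)]
  rw [hsplit]
  refine (norm_sub_le _ _).trans_lt ?_
  have := norm_add_le (a * e - a) (a * (e * (w : A) - e))
  linarith

end Representation

/-! ### Commutator seminorms and the dual form of the distance -/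

section Seminorms

variable {A : Type u} [NonUnitalCStarAlgebra A] {B : NonUnitalStarSubalgebra ℂ A}

theorem quotientSeminorm_apply (a : A) : quotientSeminorm B a = ⨅ b : B, ‖a - (b : A)‖ := rfl

theorem Triple.seminorm_apply (T : Triple.{u, v} B) (c : A) :
    T.seminorm c = (1 / 2 : ℝ) * ‖⁅T.U, T.π c⁆‖ := rfl

theorem quotientSeminorm_eq_zero_of_mem {b : A} (hb : b ∈ B) : quotientSeminorm B b = 0 := by
  refine le_antisymm ?_ (apply_nonneg _ _)
  rw [quotientSeminorm_apply]
  exact (ciInf_le (bddBelow_norm_sub B b) ⟨b, hb⟩).trans (by simp)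

theorem Triple.norm_π_le (T : Triple.{u, v} B) (a : A) : ‖T.π a‖ ≤ ‖a‖ :=
  NonUnitalStarAlgHom.norm_apply_le T.π a

theorem Triple.norm_U_le (T : Triple.{u, v} B) : ‖T.U‖ ≤ 1 := by
  have h := CStarRing.norm_star_mul_self (x := T.U)
  rw [(Unitary.mem_iff.1 T.unitary_mem).1] at h
  have h1 : ‖(1 : T.H →L[ℂ] T.H)‖ ≤ 1 := ContinuousLinearMap.norm_id_le
  nlinarith [norm_nonneg T.U]

theorem Triple.seminorm_le (T : Triple.{u, v} B) (c : A) :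
    T.seminorm c ≤ quotientSeminorm B c := by
  rw [quotientSeminorm_apply, T.seminorm_apply]
  refine le_ciInf fun b => ?_
  have h : ⁅T.U, T.π c⁆ = T.U * T.π (c - b) - T.π (c - b) * T.U := by
    have hb : T.U * T.π b - T.π b * T.U = 0 := T.commutes b b.2
    rw [Ring.lie_def, map_sub, mul_sub, sub_mul, sub_sub_sub_comm, hb, sub_zero]
  have h1 : ‖T.U * T.π (c - b)‖ ≤ 1 * ‖c - b‖ := (norm_mul_le _ _).trans
    (mul_le_mul T.norm_U_le (T.norm_π_le _) (norm_nonneg _) zero_le_one)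
  have h2 : ‖T.π (c - b) * T.U‖ ≤ ‖c - b‖ * 1 := (norm_mul_le _ _).trans
    (mul_le_mul (T.norm_π_le _) T.norm_U_le (norm_nonneg _) (norm_nonneg _))
  have h3 := norm_sub_le (T.U * T.π (c - b)) (T.π (c - b) * T.U)
  rw [h]
  linarith

theorem Triple.lie_π_mul (T : Triple.{u, v} B) (a c : A) :
    ⁅T.U, T.π (a * c)⁆ = ⁅T.U, T.π a⁆ * T.π c + T.π a * ⁅T.U, T.π c⁆ := by
  simp only [map_mul, Ring.lie_def]
  noncomm_ring

theorem Triple.isLeibniz_seminorm (T : Triple.{u, v} B) : IsLeibniz T.seminorm := by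
  intro a c
  simp only [T.seminorm_apply]
  have h1 : ‖⁅T.U, T.π a⁆ * T.π c‖ ≤ ‖⁅T.U, T.π a⁆‖ * ‖c‖ := (norm_mul_le _ _).trans
    (mul_le_mul_of_nonneg_left (T.norm_π_le c) (norm_nonneg _))
  have h2 : ‖T.π a * ⁅T.U, T.π c⁆‖ ≤ ‖a‖ * ‖⁅T.U, T.π c⁆‖ := (norm_mul_le _ _).trans
    (mul_le_mul_of_nonneg_right (T.norm_π_le a) (norm_nonneg _))
  have h3 := norm_add_le (⁅T.U, T.π a⁆ * T.π c) (T.π a * ⁅T.U, T.π c⁆)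
  rw [T.lie_π_mul]
  linarith

/-- Derivation rule for inverses: `[U, π(a')] = -π(a') [U, π(a)] π(a')`. -/
theorem Triple.seminorm_inverse_le (T : Triple.{u, v} B) {e : A} (he : IsIdentity e)
    (heB : e ∈ B) {a a' : A} (h : a * a' = e) (h' : a' * a = e) :
    T.seminorm a' ≤ ‖a'‖ ^ 2 * T.seminorm a := by
  have hD : ⁅T.U, T.π a'⁆ = -(T.π a' * ⁅T.U, T.π a⁆ * T.π a') := by
    have h0 : ⁅T.U, T.π a⁆ * T.π a' + T.π a * ⁅T.U, T.π a'⁆ = 0 := by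
      rw [← T.lie_π_mul, h, T.commutes e heB]
    -- Applying the derivation rule to `e * a' = a'` avoids proving `π(e) = 1`.
    have h1 : ⁅T.U, T.π a'⁆ = T.π e * ⁅T.U, T.π a'⁆ := by
      have := T.lie_π_mul e a'
      rwa [(he a').1, T.commutes e heB, zero_mul, zero_add] at this
    rw [h1, ← h', map_mul, mul_assoc, eq_neg_of_add_eq_zero_right h0, mul_neg, mul_assoc]
  simp only [T.seminorm_apply]
  have h2 : ‖⁅T.U, T.π a'⁆‖ ≤ ‖a'‖ * ‖⁅T.U, T.π a⁆‖ * ‖a'‖ := by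
    rw [hD, norm_neg]
    refine (norm_mul_le _ _).trans (mul_le_mul ((norm_mul_le _ _).trans
      (mul_le_mul_of_nonneg_right (T.norm_π_le a') (norm_nonneg _))) (T.norm_π_le a')
      (norm_nonneg _) (by positivity))
  nlinarith

/-- The distance to a closed subalgebra is attained by a functional which vanishes on it. -/
theorem exists_functional_eq_quotientSeminorm (hB : IsClosed (B : Set A)) (a : A) :
    ∃ f : A →L[ℂ] ℂ, ‖f‖ ≤ 1 ∧ (∀ b ∈ B, f b = 0) ∧ f a = (quotientSeminorm B a : ℂ) := by
  let S : Submodule ℂ A := B.toNonUnitalSubalgebra.toSubmodule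
  have : IsClosed (S : Set A) := hB
  obtain ⟨g, hg, hga⟩ := exists_dual_vector'' ℂ (S.mkQ a)
  refine ⟨g.comp S.mkQL, ?_, ?_, ?_⟩
  · refine ContinuousLinearMap.opNorm_le_bound _ zero_le_one fun x => ?_
    exact (g.le_of_opNorm_le hg _).trans
      (mul_le_mul_of_nonneg_left (Submodule.Quotient.norm_mk_le S x) zero_le_one)
  · intro b hb
    have : S.mkQ b = 0 := (Submodule.Quotient.mk_eq_zero S).2 hb
    change g (S.mkQ b) = 0
    rw [this, map_zero]
  · change g (S.mkQ a) = _
    rw [hga]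
    refine congrArg Complex.ofReal ?_
    have h : ‖S.mkQ a‖ = Metric.infDist a (S : Set A) :=
      QuotientAddGroup.norm_mk (S := S.toAddSubgroup) a
    rw [h, Metric.infDist_eq_iInf, quotientSeminorm_apply]
    simp only [dist_eq_norm]
    rfl

end Seminorms

/-! ### Attaining the distance; Leibniz properties -/

section DistanceFormula

variable {A : Type u} [NonUnitalCStarAlgebra A] {B : NonUnitalStarSubalgebra ℂ A}

/-- Each `j a` is the limit of `j (e a) = π(e) (j a)` along the approximate unit. -/
theorem isNondegenerate_of_denseRange {H : Type v} [NormedAddCommGroup H] [InnerProductSpace ℂ H]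
    [CompleteSpace H] {π : A →⋆ₙₐ[ℂ] (H →L[ℂ] H)} {j : A →ₗ[ℂ] H} (hj : DenseRange j)
    (hπ : ∀ a x, π a (j x) = j (a * x)) (hle : ∀ a, ‖j a‖ ≤ ‖a‖) {l : Filter A}
    (hl : l.IsApproximateUnit) : IsNondegenerate π := by
  have := hl.neBot
  have hjc : Continuous j := (LinearMap.mkContinuous j 1 (by simpa using hle)).continuous
  refine (Submodule.dense_iff_topologicalClosure_eq_top).1 ?_
  refine (dense_closure.1 <| hj.mono ?_)
  rintro _ ⟨a, rfl⟩
  refine mem_closure_of_tendsto ((hjc.tendsto a).comp (hl.tendsto_mul_right a))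
    (Eventually.of_forall fun e => Submodule.subset_span ⟨e, j a, hπ e a⟩)

/-- Invariance under `S` means `P S P = S P`; comparing this for `T` with the adjoint of the
identity for `star T` gives `P T = T P`. -/
theorem commute_starProjection_of_invariant {H : Type v} [NormedAddCommGroup H]
    [InnerProductSpace ℂ H] [CompleteSpace H] (K : Submodule ℂ H) [K.HasOrthogonalProjection]
    {T : H →L[ℂ] H} (hT : ∀ x ∈ K, T x ∈ K) (hT' : ∀ x ∈ K, (star T) x ∈ K) :
    K.starProjection * T = T * K.starProjection := by
  set P := K.starProjection with hP
  have hPs : star P = P := isSelfAdjoint_starProjection K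
  have inv : ∀ S : H →L[ℂ] H, (∀ x ∈ K, S x ∈ K) → P * (S * P) = S * P := by
    intro S hS
    ext x
    exact Submodule.starProjection_eq_self_iff.2 (hS _ (K.starProjection_apply_mem x))
  have h1 := inv T hT
  have h2 := congrArg star (inv (star T) hT')
  simp only [star_mul, star_star, hPs] at h2
  rw [← h1, ← mul_assoc, h2]

open scoped InnerProductSpace in
theorem exists_triple_eq (hB : IsClosed (B : Set A))
    (hBA : ContainsBoundedApproximateIdentity B) (a : A) :
    ∃ T : Triple.{u, u} B, quotientSeminorm B a = (1 / 2 : ℝ) * ‖⁅T.U, T.π a⁆‖ := by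
  obtain ⟨f, hf, hfB, hfa⟩ := exists_functional_eq_quotientSeminorm hB a
  obtain ⟨H, _, _, _, π, j, η, hj, hπ, hle, hη, hηf⟩ := exists_representation_of_functional f hf
  have hjc : Continuous j := (LinearMap.mkContinuous j 1 (by simpa using hle)).continuous
  let K : Submodule ℂ H :=
    (B.toNonUnitalSubalgebra.toSubmodule.map j).topologicalClosure
  have : CompleteSpace K := (Submodule.isClosed_topologicalClosure _).completeSpace_coe
  have hmem : ∀ b ∈ B, j b ∈ K := fun b hb =>
    Submodule.le_topologicalClosure _ ⟨b, hb, rfl⟩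
  have hinv : ∀ b ∈ B, ∀ x ∈ K, π b x ∈ K := by
    intro b hb x hx
    refine map_mem_closure (π b).continuous hx ?_
    rintro _ ⟨c, hc, rfl⟩
    exact ⟨b * c, B.mul_mem hb hc, (hπ b c).symm⟩
  have hηK : ∀ x ∈ K, ⟪η, x⟫_ℂ = 0 := by
    intro x hx
    refine closure_minimal (t := {x | ⟪η, x⟫_ℂ = 0}) ?_
      (isClosed_eq (by fun_prop) continuous_const) hx
    rintro _ ⟨c, hc, rfl⟩
    exact (hηf c).trans (hfB c hc)
  set P := K.starProjection with hP
  have hPs : star P = P := isSelfAdjoint_starProjection K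
  have hPP : P * P = P := K.isIdempotentElem_starProjection
  have hPB : ∀ b ∈ B, P * π b = π b * P := fun b hb =>
    commute_starProjection_of_invariant K (hinv b hb) fun x hx => by
      rw [← map_star]
      exact hinv _ (star_mem hb) x hx
  have hUs : star (2 * P - 1) = 2 * P - 1 := by
    rw [two_mul, star_sub, star_add, hPs, star_one]
  have hUU : (2 * P - 1) * (2 * P - 1) = 1 := by
    have : (2 * P - 1) * (2 * P - 1) = 4 * (P * P) - 4 * P + 1 := by noncomm_ring
    rw [this, hPP, sub_self, zero_add]
  have hlie : ∀ T : H →L[ℂ] H, ⁅2 * P - 1, T⁆ = (2 : ℂ) • (P * T - T * P) := by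
    intro T
    rw [Ring.lie_def, two_smul]
    noncomm_ring
  obtain ⟨l, hl, -⟩ := id hBA
  let T : Triple.{u, u} B :=
    { H := H
      π := π
      nondegenerate := isNondegenerate_of_denseRange hj hπ hle hl
      U := 2 * P - 1
      hermitian := hUs
      unitary_mem := Unitary.mem_iff.2 (by rw [hUs]; exact ⟨hUU, hUU⟩)
      commutes := fun b hb => by rw [hlie, hPB b hb, sub_self, smul_zero] }
  refine ⟨T, le_antisymm ?_ (T.seminorm_le a)⟩
  have hhalf : (1 / 2 : ℝ) * ‖⁅T.U, T.π a⁆‖ = ‖P * π a - π a * P‖ := by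
    change (1 / 2 : ℝ) * ‖⁅2 * P - 1, π a⁆‖ = _
    rw [hlie, norm_smul]
    simp
  rw [hhalf]
  have hbound : ∀ w ∈ B, ‖w‖ ≤ 1 → ‖f (a * w)‖ ≤ ‖P * π a - π a * P‖ := by
    intro w hw hw1
    -- The first term dies because `η ⟂ K`; in the second, `P` fixes `j w ∈ K`.
    have hval : ⟪η, (P * π a - π a * P) (j w)⟫_ℂ = -f (a * w) := by
      have h1 : (P * π a - π a * P) (j w) = P (π a (j w)) - π a (P (j w)) := rfl
      rw [h1, inner_sub_right, hηK _ (K.starProjection_apply_mem _),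
        Submodule.starProjection_eq_self_iff.2 (hmem w hw), hπ, hηf, zero_sub]
    rw [← norm_neg, ← hval]
    calc ‖⟪η, (P * π a - π a * P) (j w)⟫_ℂ‖
        ≤ ‖η‖ * ‖(P * π a - π a * P) (j w)‖ := norm_inner_le_norm _ _
      _ ≤ 1 * (‖P * π a - π a * P‖ * 1) := by
        gcongr
        refine (ContinuousLinearMap.le_opNorm _ _).trans ?_
        gcongr
        exact (hle w).trans hw1
      _ = ‖P * π a - π a * P‖ := by ring
  refine le_of_forall_pos_le_add fun ε hε => ?_
  obtain ⟨w, hw, hw1, hwε⟩ := exists_norm_le_one_mul_sub_lt hB hBA a hε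
  have h1 : ‖f (a * w) - f a‖ ≤ ε := by
    rw [← map_sub]
    refine (f.le_of_opNorm_le hf _).trans ?_
    linarith
  have h2 : ‖f a‖ = quotientSeminorm B a := by
    rw [hfa, Complex.norm_real, Real.norm_of_nonneg (apply_nonneg _ _)]
  have h3 : ‖f a‖ ≤ ‖f (a * w)‖ + ‖f (a * w) - f a‖ := by
    rw [norm_sub_rev]
    exact norm_le_norm_add_norm_sub' _ _
  have h4 := hbound w hw hw1
  linarith

/-- One triple attains `L` at the product `a * c`; in its Leibniz inequality the right-hand side
only grows when its seminorm is replaced by `L`. -/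
theorem isLeibniz_quotientSeminorm (hB : IsClosed (B : Set A))
    (hBA : ContainsBoundedApproximateIdentity B) : IsLeibniz (quotientSeminorm B) := by
  intro a c
  obtain ⟨T, hT⟩ := exists_triple_eq hB hBA (a * c)
  rw [hT, ← T.seminorm_apply]
  exact (T.isLeibniz_seminorm a c).trans (add_le_add
    (mul_le_mul_of_nonneg_right (T.seminorm_le a) (norm_nonneg _))
    (mul_le_mul_of_nonneg_left (T.seminorm_le c) (norm_nonneg _)))

theorem isStronglyLeibniz_quotientSeminorm (hB : IsClosed (B : Set A))
    (hBA : ContainsBoundedApproximateIdentity B) {e : A} (he : IsIdentity e) (heB : e ∈ B) :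
    IsStronglyLeibniz e (quotientSeminorm B) := by
  refine ⟨isLeibniz_quotientSeminorm hB hBA, quotientSeminorm_eq_zero_of_mem heB,
    fun a a' h h' => ?_⟩
  obtain ⟨T, hT⟩ := exists_triple_eq hB hBA a'
  rw [hT, ← T.seminorm_apply]
  exact (T.seminorm_inverse_le he heB h h').trans
    (mul_le_mul_of_nonneg_left (T.seminorm_le a) (by positivity))

end DistanceFormula

end CStarDist

theorem theorem3p2 {A : Type u} [NonUnitalCStarAlgebra A] (B : NonUnitalStarSubalgebra ℂ A)
    (hB : IsClosed (B : Set A)) (hBA : CStarDist.ContainsBoundedApproximateIdentity B) :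
    -- the distance formula
    (∀ a : A, ∃ T : CStarDist.Triple.{u, u} B, CStarDist.quotientSeminorm B a = (1 / 2 : ℝ) * ‖⁅T.U, T.π a⁆‖) ∧
    -- `L` is the supremum of the seminorms `L_(H, π, U)`; Hilbert spaces in any other universe
    -- give nothing larger
    (∀ c : A, IsLUB (Set.range fun T : CStarDist.Triple.{u, u} B => T.seminorm c) (CStarDist.quotientSeminorm B c)) ∧
    (∀ (T : CStarDist.Triple.{u, v} B) (c : A), T.seminorm c ≤ CStarDist.quotientSeminorm B c) ∧
    -- the Leibniz property
    (∀ T : CStarDist.Triple.{u, v} B, CStarDist.IsLeibniz T.seminorm) ∧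
    CStarDist.IsLeibniz (CStarDist.quotientSeminorm B) ∧
    -- the unital case
    (∀ e : A, CStarDist.IsIdentity e → e ∈ B → CStarDist.IsStronglyLeibniz e (CStarDist.quotientSeminorm B)) := by
  refine ⟨CStarDist.exists_triple_eq hB hBA, fun c => ⟨?_, fun x hx => ?_⟩,
    fun T => T.seminorm_le, fun T => T.isLeibniz_seminorm,
    CStarDist.isLeibniz_quotientSeminorm hB hBA,
    fun e he heB => CStarDist.isStronglyLeibniz_quotientSeminorm hB hBA he heB⟩
  · rintro _ ⟨T, rfl⟩
    exact T.seminorm_le c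
  · obtain ⟨T, hT⟩ := CStarDist.exists_triple_eq hB hBA c
    rw [hT]
    exact hx ⟨T, rfl⟩
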